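/- Let $n\ge 2$ be an even integer and let $p>0$ be real. Let $|\mathbb S^n|$ denote the volume of the standard unit $n$-sphere. Let $u:\mathbb R^n\to\mathbb R$ be a continuous function that is radially symmetric about the origin, satisfies $(1+|x|^{np})e^{nu}\in L^1(\mathbb R^n)$, and solves, for some constant $C\in\mathbb R$, the integral equation $$u(x)=\frac{2}{(n-1)!\,|\mathbb S^n|}\int_{\mathbb R^n}\log\frac{|y|}{|x-y|}\,\bigl(1+|y|^{np}\bigr)e^{nu(y)}\,dy+C\qquad\text{for all }x\in\mathbb R^n$$ (that is, $u$ is a radial normal solution with $Q(x)=1+|x|^{np}$). Set $$\beta:=\frac{2}{(n-1)!\,|\mathbb S^n|}\int_{\mathbb R^n}(1+|x|^{np})e^{nu(x)}\,dx .$$ Then $$\max\{2,2p\}<\beta<2+2p .$$ -/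

import Mathlib

open MeasureTheory
open scoped Nat

/-- The volume `|𝕊ⁿ|` of the standard unit `n`-sphere, the unit sphere of `ℝⁿ⁺¹` with its
surface measure. -/
noncomputable def sphereVolume (n : ℕ) : ℝ :=
  ((volume : Measure (EuclideanSpace ℝ (Fin (n + 1)))).toSphere).real Set.univ

/-- The normalizing constant `2 / ((n - 1)! |𝕊ⁿ|)` (used for `n ≥ 2`). -/
noncomputable def normConst (n : ℕ) : ℝ :=
  2 / (((n - 1)! : ℕ) * sphereVolume n)

/-- `u` is a normal solution of `(-Δ)^(n/2) u = Q e^(n u)` on `ℝⁿ`: the function `Q e^(n u)` is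
integrable and, for some constant `C` and all `x`,
`u(x) = 2 / ((n - 1)! |𝕊ⁿ|) * ∫ log (|y| / |x - y|) Q(y) e^(n u(y)) dy + C`. -/
structure IsNormalSolution (n : ℕ) (Q u : EuclideanSpace ℝ (Fin n) → ℝ) : Prop where
  continuous : Continuous u
  integrable : Integrable (fun y => Q y * Real.exp (n * u y))
  /-- The integral in the equation exists. When `Q` is continuous this already follows from the
  other fields. -/
  integrable_log : ∀ x, Integrable
    (fun y => Real.log (‖y‖ / ‖x - y‖) * (Q y * Real.exp (n * u y)))
  equation : ∃ C : ℝ, ∀ x, u x =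
    normConst n * (∫ y, Real.log (‖y‖ / ‖x - y‖) * (Q y * Real.exp (n * u y))) + C

/-- The normalized integrated Q-curvature `2 / ((n - 1)! |𝕊ⁿ|) * ∫ Q e^(n u) dx`. -/
noncomputable def normalizedTotalQ (n : ℕ) (Q u : EuclideanSpace ℝ (Fin n) → ℝ) : ℝ :=
  normConst n * ∫ x, Q x * Real.exp (n * u x)

/-- Radial symmetry about the origin. -/
def IsRadial {n : ℕ} (u : EuclideanSpace ℝ (Fin n) → ℝ) : Prop :=
  ∀ x y, ‖x‖ = ‖y‖ → u x = u y

/-- The function `Q(x) = 1 + |x|^(n p)` on `ℝⁿ`. -/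
noncomputable def powerQ (n : ℕ) (p : ℝ) (x : EuclideanSpace ℝ (Fin n)) : ℝ :=
  1 + ‖x‖ ^ ((n : ℝ) * p)

/-!
As `n` is even, `ℝⁿ` is a complex inner product space, and circle invariant functions may replace
radial ones. Averaging `log |x - z y|` over `|z| = 1` gives `log m(x, y)`, where `m(x, y)` is half
the sum of the largest and the smallest distance from `x` to the orbit of `y`. The derivative
`k(x, y)` of `log m(x, y)` under dilation of `x` satisfies `0 ≤ k ≤ 1` and
`k(x, y) + k(y, x) = 1`.

Write the density as `f₀ + f₁`, where `f₀` is a multiple of `e^(a u)` and `f₁ = |x|^q f₀`, and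
integrate the divergences of `f₀ x` and `f₁ x`. With `B(f, g) = ∬ k(x, y) f(x) g(y)` and
`bᵢ = a ∫ fᵢ`, this gives `d b₀ = a² B(f₀, f₀ + f₁)` and `(d + q) b₁ = a² B(f₁, f₀ + f₁)`.
The symmetry of `k` yields `B(f, f) = (∫ f)² / 2` and `a² (B(f₀, f₁) + B(f₁, f₀)) = b₀ b₁`, while
`B(f₀, f₁)` and `B(f₁, f₀)` are positive. Hence, with `S = b₀ + b₁`, one has
`S (S - 2 d) = 2 q b₁` and `b₀ < 2 d`, from which the three inequalities follow.
-/

section Orbit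

variable {E : Type*} [NormedAddCommGroup E] [InnerProductSpace ℂ E]

/-- The largest distance from `x` to a point `z • y`, `|z| = 1`, of the circle orbit of `y`. -/
noncomputable def orbitFar (x y : E) : ℝ := √(‖x‖ ^ 2 + ‖y‖ ^ 2 + 2 * ‖inner ℂ x y‖)

/-- The smallest distance from `x` to a point `z • y`, `|z| = 1`, of the circle orbit of `y`. -/
noncomputable def orbitNear (x y : E) : ℝ := √(‖x‖ ^ 2 + ‖y‖ ^ 2 - 2 * ‖inner ℂ x y‖)

/-- The geometric mean of the distances from `x` to the points of the circle orbit of `y`, see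
`circleAverage_log_norm_sub_smul`. -/
noncomputable def orbitMean (x y : E) : ℝ := (orbitFar x y + orbitNear x y) / 2

/-- The derivative of `log (orbitMean x y)` under dilation of `x`, see
`hasDerivAt_log_orbitMean_exp_smul`. It is `1 / 2` where `orbitNear x y = 0`. -/
noncomputable def orbitSlope (x y : E) : ℝ :=
  (1 + (‖x‖ ^ 2 - ‖y‖ ^ 2) / (orbitFar x y * orbitNear x y)) / 2

theorem two_mul_norm_inner_le (x y : E) : 2 * ‖inner ℂ x y‖ ≤ ‖x‖ ^ 2 + ‖y‖ ^ 2 := by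
  nlinarith [norm_inner_le_norm (𝕜 := ℂ) x y, sq_nonneg (‖x‖ - ‖y‖)]

theorem orbitFar_sq (x y : E) : orbitFar x y ^ 2 = ‖x‖ ^ 2 + ‖y‖ ^ 2 + 2 * ‖inner ℂ x y‖ :=
  Real.sq_sqrt (by positivity)

theorem orbitNear_sq (x y : E) : orbitNear x y ^ 2 = ‖x‖ ^ 2 + ‖y‖ ^ 2 - 2 * ‖inner ℂ x y‖ :=
  Real.sq_sqrt (by linarith [two_mul_norm_inner_le x y])

theorem orbitFar_nonneg (x y : E) : 0 ≤ orbitFar x y := Real.sqrt_nonneg _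

theorem orbitNear_nonneg (x y : E) : 0 ≤ orbitNear x y := Real.sqrt_nonneg _

theorem orbitFar_comm (x y : E) : orbitFar x y = orbitFar y x := by
  rw [orbitFar, orbitFar, norm_inner_symm, add_comm (‖x‖ ^ 2)]

theorem orbitNear_comm (x y : E) : orbitNear x y = orbitNear y x := by
  rw [orbitNear, orbitNear, norm_inner_symm, add_comm (‖x‖ ^ 2)]

theorem orbitMean_comm (x y : E) : orbitMean x y = orbitMean y x := by
  rw [orbitMean, orbitMean, orbitFar_comm, orbitNear_comm]

theorem orbitFar_pos (x : E) {y : E} (hy : y ≠ 0) : 0 < orbitFar x y := by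
  have := norm_pos_iff.2 hy
  exact Real.sqrt_pos.2 (by positivity)

theorem orbitNear_pos {x y : E} (h : ‖x‖ ≠ ‖y‖) : 0 < orbitNear x y := by
  have := sq_pos_of_ne_zero (sub_ne_zero.2 h)
  exact Real.sqrt_pos.2 (by nlinarith [norm_inner_le_norm (𝕜 := ℂ) x y])

theorem orbitMean_pos (x : E) {y : E} (hy : y ≠ 0) : 0 < orbitMean x y :=
  half_pos (add_pos_of_pos_of_nonneg (orbitFar_pos x hy) (orbitNear_nonneg x y))

theorem abs_sub_norm_sq_le_orbitFar_mul_orbitNear (x y : E) :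
    |‖x‖ ^ 2 - ‖y‖ ^ 2| ≤ orbitFar x y * orbitNear x y := by
  refine abs_le_of_sq_le_sq ?_ (mul_nonneg (orbitFar_nonneg x y) (orbitNear_nonneg x y))
  have hw := pow_le_pow_left₀ (norm_nonneg _) (norm_inner_le_norm (𝕜 := ℂ) x y) 2
  rw [mul_pow, orbitFar_sq, orbitNear_sq]
  linarith

theorem orbitSlope_add_swap (x y : E) : orbitSlope x y + orbitSlope y x = 1 := by
  rw [orbitSlope, orbitSlope, orbitFar_comm y x, orbitNear_comm y x]
  ring

theorem orbitSlope_nonneg (x y : E) : 0 ≤ orbitSlope x y := by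
  have hD := mul_nonneg (orbitFar_nonneg x y) (orbitNear_nonneg x y)
  have : |(‖x‖ ^ 2 - ‖y‖ ^ 2) / (orbitFar x y * orbitNear x y)| ≤ 1 := by
    rw [abs_div, abs_of_nonneg hD]
    exact div_le_one_of_le₀ (abs_sub_norm_sq_le_orbitFar_mul_orbitNear x y) hD
  rw [orbitSlope]
  linarith [(abs_le.1 this).1]

theorem orbitSlope_le_one (x y : E) : orbitSlope x y ≤ 1 := by
  linarith [orbitSlope_add_swap x y, orbitSlope_nonneg y x]

theorem orbitSlope_pos {x y : E} (h : ‖y‖ < ‖x‖) : 0 < orbitSlope x y := by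
  have : 0 ≤ (‖x‖ ^ 2 - ‖y‖ ^ 2) / (orbitFar x y * orbitNear x y) :=
    div_nonneg (sub_nonneg.2 (by gcongr)) (mul_nonneg (orbitFar_nonneg x y) (orbitNear_nonneg x y))
  rw [orbitSlope]
  linarith

theorem orbitMean_sq_mul_sub (x y : E) :
    orbitMean x y ^ 2 * (‖x‖ ^ 2 + ‖y‖ ^ 2 - orbitMean x y ^ 2) = ‖inner ℂ x y‖ ^ 2 := by
  have hsum : ‖x‖ ^ 2 + ‖y‖ ^ 2 = (orbitFar x y ^ 2 + orbitNear x y ^ 2) / 2 := by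
    rw [orbitFar_sq, orbitNear_sq]
    ring
  have hinner : ‖inner ℂ x y‖ = (orbitFar x y ^ 2 - orbitNear x y ^ 2) / 4 := by
    rw [orbitFar_sq, orbitNear_sq]
    ring
  rw [hsum, hinner, orbitMean]
  ring

theorem norm_orbitMean_mul_sub (x : E) {y : E} (hy : y ≠ 0) {z : ℂ} (hz : ‖z‖ = 1) :
    ‖orbitMean x y * z - inner ℂ y x / orbitMean x y‖ = ‖x - z • y‖ := by
  have hm := (orbitMean_pos x hy).ne'
  have hquot : ‖inner ℂ y x / (orbitMean x y : ℂ)‖ ^ 2 =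
      ‖x‖ ^ 2 + ‖y‖ ^ 2 - orbitMean x y ^ 2 := by
    rw [norm_div, div_pow, Complex.norm_real, Real.norm_eq_abs, sq_abs, norm_inner_symm,
      ← orbitMean_sq_mul_sub, mul_div_cancel_left₀ _ (pow_ne_zero 2 hm)]
  have hcross : inner ℂ (orbitMean x y * z) (inner ℂ y x / orbitMean x y) =
      starRingEnd ℂ (inner ℂ x (z • y)) := by
    have : (orbitMean x y : ℂ) ≠ 0 := Complex.ofReal_ne_zero.2 hm
    rw [RCLike.inner_apply, inner_smul_right, map_mul, map_mul, inner_conj_symm,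
      Complex.conj_ofReal]
    field_simp
  have hnorm : ‖(orbitMean x y * z : ℂ)‖ ^ 2 = orbitMean x y ^ 2 := by
    rw [norm_mul, hz, mul_one, Complex.norm_real, Real.norm_eq_abs, sq_abs]
  refine (sq_eq_sq₀ (norm_nonneg _) (norm_nonneg _)).1 ?_
  rw [norm_sub_sq (𝕜 := ℂ), norm_sub_sq (𝕜 := ℂ), hquot, hcross, hnorm, norm_smul, hz, one_mul,
    RCLike.conj_re]
  ring

/-- Jensen's formula on the circle of radius `orbitMean x y`. -/
theorem circleAverage_log_norm_sub_smul (x : E) {y : E} (hy : y ≠ 0) :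
    Real.circleAverage (fun z => Real.log ‖x - z • y‖) 0 1 = Real.log (orbitMean x y) := by
  have hm := orbitMean_pos x hy
  have hcenter : inner ℂ y x / (orbitMean x y : ℂ) ∈ Metric.closedBall 0 |orbitMean x y| := by
    rw [mem_closedBall_zero_iff, norm_div, Complex.norm_real, Real.norm_eq_abs, abs_of_pos hm,
      div_le_iff₀ hm, norm_inner_symm, orbitMean]
    nlinarith [orbitFar_sq x y, orbitNear_sq x y, orbitFar_nonneg x y, orbitNear_nonneg x y]
  rw [← circleAverage_log_norm_sub_const_of_mem_closedBall hcenter,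
    Real.circleAverage_eq_circleAverage_zero_one (R := orbitMean x y)]
  refine Real.circleAverage_congr_sphere fun z hz => ?_
  rw [abs_one, mem_sphere_zero_iff_norm] at hz
  simp only [add_zero, norm_orbitMean_mul_sub x hy hz]

theorem norm_add_add_norm_sub_le {V : Type*} [SeminormedAddCommGroup V] [NormedSpace ℝ V]
    (v w : V) {r : ℝ} (hr : 1 ≤ r) : ‖v + w‖ + ‖v - w‖ ≤ ‖r • v + w‖ + ‖r • v - w‖ := by
  have hr0 : r ≠ 0 := (one_pos.trans_le hr).ne'
  have hl : 0 ≤ (1 + r⁻¹) / 2 := by positivity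
  have hl' : 0 ≤ (1 - r⁻¹) / 2 := by linarith [inv_le_one_of_one_le₀ hr]
  have hsplit (w : V) : ‖v + w‖ ≤ (1 + r⁻¹) / 2 * ‖r • v + w‖ + (1 - r⁻¹) / 2 * ‖r • v - w‖ := by
    have : v + w = ((1 + r⁻¹) / 2) • (r • v + w) - ((1 - r⁻¹) / 2) • (r • v - w) := by
      match_scalars <;> field_simp <;> ring
    calc ‖v + w‖ = ‖((1 + r⁻¹) / 2) • (r • v + w) - ((1 - r⁻¹) / 2) • (r • v - w)‖ := by rw [← this]
      _ ≤ _ := norm_sub_le _ _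
      _ = _ := by rw [norm_smul_of_nonneg hl, norm_smul_of_nonneg hl']
  have h1 := hsplit w
  have h2 := hsplit (-w)
  rw [← sub_eq_add_neg, ← sub_eq_add_neg, sub_neg_eq_add] at h2
  linarith

theorem exists_orbitMean_smul_eq (x y : E) : ∃ v : E, ∀ r : ℝ, 0 ≤ r →
    orbitMean (r • x) y = (‖r • x + v‖ + ‖r • x - v‖) / 2 := by
  obtain ⟨c, hc, hcxy⟩ := RCLike.exists_norm_eq_mul_self (inner ℂ x y)
  have hinner (r : ℝ) (hr : 0 ≤ r) :
      RCLike.re (inner ℂ (r • x) (c • y)) = ‖inner ℂ (r • x) y‖ := by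
    rw [← Complex.coe_smul, inner_smul_left, inner_smul_left, inner_smul_right, ← hcxy,
      Complex.conj_ofReal, norm_mul, Complex.norm_real, Real.norm_of_nonneg hr]
    exact Complex.re_ofReal_mul _ _
  refine ⟨c • y, fun r hr => ?_⟩
  have hnorm : ‖c • y‖ = ‖y‖ := by rw [norm_smul, hc, one_mul]
  rw [orbitMean, orbitFar, orbitNear, ← hinner r hr, ← hnorm]
  congr 2
  · rw [← Real.sqrt_sq (norm_nonneg (r • x + c • y)), norm_add_sq (𝕜 := ℂ), add_right_comm]
  · rw [← Real.sqrt_sq (norm_nonneg (r • x - c • y)), norm_sub_sq (𝕜 := ℂ), sub_add_eq_add_sub]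

theorem orbitMean_le_orbitMean_smul (x y : E) {r : ℝ} (hr : 1 ≤ r) :
    orbitMean x y ≤ orbitMean (r • x) y := by
  obtain ⟨v, hv⟩ := exists_orbitMean_smul_eq x y
  have h1 := hv 1 zero_le_one
  rw [one_smul] at h1
  rw [h1, hv r (zero_le_one.trans hr)]
  linarith [norm_add_add_norm_sub_le x v hr]

theorem orbitMean_smul_smul (x y : E) {r : ℝ} (hr : 0 ≤ r) :
    orbitMean (r • x) (r • y) = r * orbitMean x y := by
  have hinner : ‖inner ℂ (r • x) (r • y)‖ = r ^ 2 * ‖inner ℂ x y‖ := by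
    rw [inner_smul_left_eq_smul, inner_smul_right_eq_smul, norm_smul_of_nonneg hr,
      norm_smul_of_nonneg hr, ← mul_assoc, sq]
  have hsqrt (a : ℝ) : √(r ^ 2 * a) = r * √a := by
    rw [Real.sqrt_mul (sq_nonneg r), Real.sqrt_sq hr]
  rw [orbitMean, orbitMean, orbitFar, orbitNear, hinner, norm_smul_of_nonneg hr,
    norm_smul_of_nonneg hr, orbitFar, orbitNear, mul_div_assoc', mul_add, ← hsqrt, ← hsqrt]
  ring_nf

theorem orbitMean_smul_le (x y : E) {r : ℝ} (hr : 1 ≤ r) :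
    orbitMean (r • x) y ≤ r * orbitMean x y := by
  rw [← orbitMean_smul_smul x y (zero_le_one.trans hr), orbitMean_comm, orbitMean_comm _ (r • y)]
  exact orbitMean_le_orbitMean_smul y (r • x) hr

theorem abs_log_orbitMean_exp_smul_sub_le (x : E) {y : E} (hy : y ≠ 0) (s t : ℝ) :
    |Real.log (orbitMean (Real.exp s • x) y) - Real.log (orbitMean (Real.exp t • x) y)| ≤
      |s - t| := by
  wlog hts : t ≤ s generalizing s t
  · rw [abs_sub_comm, abs_sub_comm s]
    exact this t s (le_of_not_ge hts)
  set w := Real.exp t • x with hw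
  have hr : 1 ≤ Real.exp (s - t) := Real.one_le_exp (sub_nonneg.2 hts)
  have hs : Real.exp s • x = Real.exp (s - t) • w := by
    rw [hw, smul_smul, ← Real.exp_add, sub_add_cancel]
  have hpos := orbitMean_pos w hy
  have hlower := Real.log_le_log hpos (orbitMean_le_orbitMean_smul w y hr)
  have hupper := Real.log_le_log (orbitMean_pos _ hy) (orbitMean_smul_le w y hr)
  rw [Real.log_mul (Real.exp_ne_zero _) hpos.ne', Real.log_exp] at hupper
  rw [hs, abs_of_nonneg (sub_nonneg.2 hlower), abs_of_nonneg (sub_nonneg.2 hts)]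
  linarith

theorem hasDerivAt_sqrt_exp {R S w t : ℝ}
    (h : 0 < Real.exp t ^ 2 * R + S + 2 * (Real.exp t * w)) :
    HasDerivAt (fun s => √(Real.exp s ^ 2 * R + S + 2 * (Real.exp s * w)))
      ((√(Real.exp t ^ 2 * R + S + 2 * (Real.exp t * w)) +
        (Real.exp t ^ 2 * R - S) / √(Real.exp t ^ 2 * R + S + 2 * (Real.exp t * w))) / 2) t := by
  have hexp := Real.hasDerivAt_exp t
  have hrad : HasDerivAt (fun s => Real.exp s ^ 2 * R + S + 2 * (Real.exp s * w))
      (2 * (Real.exp t ^ 2 * R + Real.exp t * w)) t :=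
    ((((hexp.fun_pow 2).mul_const R).add_const S).fun_add
      ((hexp.mul_const w).const_mul 2)).congr_deriv (by ring)
  refine (hrad.sqrt h.ne').congr_deriv ?_
  have hsq := Real.sq_sqrt h.le
  have hne := (Real.sqrt_pos.2 h).ne'
  set a := √(Real.exp t ^ 2 * R + S + 2 * (Real.exp t * w))
  field_simp
  rw [hsq]
  ring

theorem hasDerivAt_log_orbitMean_exp_smul {x y : E} {t : ℝ} (hy : y ≠ 0)
    (h : ‖Real.exp t • x‖ ≠ ‖y‖) :
    HasDerivAt (fun s => Real.log (orbitMean (Real.exp s • x) y))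
      (orbitSlope (Real.exp t • x) y) t := by
  have hfar_pos := orbitFar_pos (Real.exp t • x) hy
  have hnear_pos := orbitNear_pos h
  have hnorm (s : ℝ) : ‖Real.exp s • x‖ ^ 2 = Real.exp s ^ 2 * ‖x‖ ^ 2 := by
    rw [norm_smul_of_nonneg (Real.exp_pos s).le, mul_pow]
  have hinner (s : ℝ) : ‖inner ℂ (Real.exp s • x) y‖ = Real.exp s * ‖inner ℂ x y‖ := by
    rw [inner_smul_left_eq_smul, norm_smul_of_nonneg (Real.exp_pos s).le]
  have hfar : HasDerivAt (fun s => orbitFar (Real.exp s • x) y)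
      ((orbitFar (Real.exp t • x) y +
        (‖Real.exp t • x‖ ^ 2 - ‖y‖ ^ 2) / orbitFar (Real.exp t • x) y) / 2) t := by
    simp only [orbitFar, hnorm, hinner] at hfar_pos ⊢
    exact hasDerivAt_sqrt_exp (Real.sqrt_pos.1 hfar_pos)
  have hnear : HasDerivAt (fun s => orbitNear (Real.exp s • x) y)
      ((orbitNear (Real.exp t • x) y +
        (‖Real.exp t • x‖ ^ 2 - ‖y‖ ^ 2) / orbitNear (Real.exp t • x) y) / 2) t := by
    have hradicand (s : ℝ) : orbitNear (Real.exp s • x) y =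
        √(Real.exp s ^ 2 * ‖x‖ ^ 2 + ‖y‖ ^ 2 + 2 * (Real.exp s * -‖inner ℂ x y‖)) := by
      rw [orbitNear, hnorm, hinner, mul_neg, mul_neg, sub_eq_add_neg]
    simp only [hradicand, hnorm] at hnear_pos ⊢
    exact hasDerivAt_sqrt_exp (Real.sqrt_pos.1 hnear_pos)
  refine (((hfar.fun_add hnear).div_const 2).log (orbitMean_pos _ hy).ne').congr_deriv ?_
  rw [orbitSlope]
  field_simp
  ring

theorem measurable_orbitSlope [MeasurableSpace E] [BorelSpace E] [SecondCountableTopology E] :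
    Measurable fun z : E × E => orbitSlope z.1 z.2 := by
  have hfar : Continuous fun z : E × E => orbitFar z.1 z.2 := by unfold orbitFar; fun_prop
  have hnear : Continuous fun z : E × E => orbitNear z.1 z.2 := by unfold orbitNear; fun_prop
  unfold orbitSlope
  have hsub : Continuous fun z : E × E => ‖z.1‖ ^ 2 - ‖z.2‖ ^ 2 := by fun_prop
  exact ((hsub.measurable.div (hfar.mul hnear).measurable).const_add 1).div_const 2

end Orbit

section CircleAverage

variable {E : Type*} [NormedAddCommGroup E] [MeasurableSpace E] [BorelSpace E]

theorem measurePreserving_linearIsometryEquiv [NormedSpace ℝ E] [FiniteDimensional ℝ E]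
    (μ : Measure E) [μ.IsAddHaarMeasure] (e : E ≃ₗᵢ[ℝ] E) : MeasurePreserving e μ μ := by
  have hdet := e.toLinearEquiv.isUnit_det'.ne_zero
  have hmap := Measure.map_linearMap_addHaar_eq_smul_addHaar μ hdet
  change μ.map e = _ at hmap
  have hball := DFunLike.congr_fun hmap (Metric.ball 0 1)
  rw [Measure.map_apply e.continuous.measurable measurableSet_ball, e.preimage_ball, map_zero,
    Measure.smul_apply, smul_eq_mul] at hball
  have hone := (ENNReal.mul_eq_right (Metric.measure_ball_pos μ 0 one_pos).ne'
    measure_ball_lt_top.ne).1 hball.symm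
  exact ⟨e.continuous.measurable, by rw [hmap, hone, one_smul]⟩

variable [NormedSpace ℂ E] [FiniteDimensional ℂ E]

theorem measurePreserving_smul_of_norm_eq_one (μ : Measure E) [μ.IsAddHaarMeasure] {z : ℂ}
    (hz : ‖z‖ = 1) : MeasurePreserving (fun y : E => z • y) μ μ := by
  have : FiniteDimensional ℝ E := .complexToReal E
  have hz0 : z ≠ 0 := norm_ne_zero_iff.1 (by rw [hz]; exact one_ne_zero)
  exact measurePreserving_linearIsometryEquiv μ
    { (LinearEquiv.smulOfNeZero ℂ E z hz0).restrictScalars ℝ with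
      norm_map' := fun y => (norm_smul z y).trans (by rw [hz, one_mul]) }

theorem measurePreserving_circleMap_smul (μ : Measure E) [μ.IsAddHaarMeasure]
    (ν : Measure ℝ) [SFinite ν] :
    MeasurePreserving (fun w : ℝ × E => (w.1, circleMap 0 1 w.1 • w.2)) (ν.prod μ) (ν.prod μ) :=
  have := FiniteDimensional.proper ℂ E
  (MeasurePreserving.id ν).skew_product (by fun_prop) (.of_forall fun θ =>
    (measurePreserving_smul_of_norm_eq_one μ (by simp)).map_eq)

variable {μ : Measure E} [μ.IsAddHaarMeasure]

theorem integrable_and_integral_circleAverage_smul {g : E → ℝ} (hg : Integrable g μ) :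
    Integrable (fun y => Real.circleAverage (fun z => g (z • y)) 0 1) μ ∧
      ∫ y, Real.circleAverage (fun z => g (z • y)) 0 1 ∂μ = ∫ y, g y ∂μ := by
  have := FiniteDimensional.proper ℂ E
  set ν : Measure ℝ := volume.restrict (Set.Ioc 0 (2 * Real.pi)) with hν
  have hrot := measurePreserving_circleMap_smul μ ν
  have hsnd : Integrable (fun w : ℝ × E => g w.2) (ν.prod μ) := hg.comp_snd ν
  have hint : Integrable (fun w : ℝ × E => g (circleMap 0 1 w.1 • w.2)) (ν.prod μ) :=
    hrot.integrable_comp_of_integrable hsnd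
  have havg (y : E) : Real.circleAverage (fun z => g (z • y)) 0 1 =
      (2 * Real.pi)⁻¹ * ∫ θ, g (circleMap 0 1 θ • y) ∂ν := by
    rw [Real.circleAverage_def, intervalIntegral.integral_of_le Real.two_pi_pos.le, smul_eq_mul]
  have htotal : ∫ y, ∫ θ, g (circleMap 0 1 θ • y) ∂ν ∂μ = 2 * Real.pi * ∫ y, g y ∂μ := by
    have hmap := integral_map hrot.aemeasurable (hrot.map_eq.symm ▸ hsnd.aestronglyMeasurable)
    rw [← integral_prod_symm _ hint, ← hmap, hrot.map_eq, integral_fun_snd, hν,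
      measureReal_restrict_apply_univ, Real.volume_real_Ioc_of_le Real.two_pi_pos.le, sub_zero,
      smul_eq_mul]
  simp only [havg]
  refine ⟨hint.integral_prod_right.const_mul _, ?_⟩
  rw [integral_const_mul, htotal, inv_mul_cancel_left₀ Real.two_pi_pos.ne']

end CircleAverage

/-- Invariance of a function under the action of the unit circle by complex scalars. It replaces
radial symmetry, which it generalizes. -/
def IsCircleInvariant {E β : Type*} [SMul ℂ E] (f : E → β) : Prop :=
  ∀ ⦃z : ℂ⦄, ‖z‖ = 1 → ∀ x, f (z • x) = f x

/-- `u` is, up to an additive constant, the logarithmic potential of the density `K` with respect to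
`μ`, where the kernel `log (|y| / |x - y|)` is normalized to vanish at `x = 0`. -/
structure IsLogPotential {V : Type*} [NormedAddCommGroup V] [MeasurableSpace V] (μ : Measure V)
    (K u : V → ℝ) : Prop where
  integrable : Integrable K μ
  integrable_log : ∀ x, Integrable (fun y => Real.log (‖y‖ / ‖x - y‖) * K y) μ
  exists_eq : ∃ C, ∀ x, u x = ∫ y, Real.log (‖y‖ / ‖x - y‖) * K y ∂μ + C

theorem ae_ne_zero_and_norm_ne {V : Type*} [NormedAddCommGroup V] [NormedSpace ℝ V]
    [FiniteDimensional ℝ V] [Nontrivial V] [MeasurableSpace V] [BorelSpace V] (μ : Measure V)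
    [μ.IsAddHaarMeasure] (r : ℝ) : ∀ᵐ y ∂μ, y ≠ 0 ∧ ‖y‖ ≠ r := by
  filter_upwards [measure_eq_zero_iff_ae_notMem.1 (Measure.addHaar_sphere μ (0 : V) 0),
    measure_eq_zero_iff_ae_notMem.1 (Measure.addHaar_sphere μ (0 : V) r)] with y hy0 hyr
  rw [mem_sphere_zero_iff_norm] at hy0 hyr
  exact ⟨norm_ne_zero_iff.1 hy0, hyr⟩

section Potential

variable {E : Type*} [NormedAddCommGroup E] [InnerProductSpace ℂ E]

theorem circleAverage_log_div_mul {K : E → ℝ} (hK : IsCircleInvariant K)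
    {x y : E} (hy : y ≠ 0) (hyx : ‖y‖ ≠ ‖x‖) :
    Real.circleAverage (fun z => Real.log (‖z • y‖ / ‖x - z • y‖) * K (z • y)) 0 1 =
      (Real.log ‖y‖ - Real.log (orbitMean x y)) * K y := by
  have hsub {z : ℂ} (hz : z ∈ Metric.sphere 0 |1|) : ‖x - z • y‖ ≠ 0 := fun h => hyx <| by
    rw [sub_eq_zero.1 (norm_eq_zero.1 h), norm_smul, mem_sphere_zero_iff_norm.1 hz, abs_one,
      one_mul]
  have hint : CircleIntegrable (fun z : ℂ => Real.log ‖x - z • y‖) 0 1 :=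
    ContinuousOn.circleIntegrable' (.log (by fun_prop) fun z hz => hsub hz)
  calc Real.circleAverage (fun z => Real.log (‖z • y‖ / ‖x - z • y‖) * K (z • y)) 0 1
      = Real.circleAverage (fun z => K y • (Real.log ‖y‖ - Real.log ‖x - z • y‖)) 0 1 := by
        refine Real.circleAverage_congr_sphere fun z hz => ?_
        have hz1 : ‖z‖ = 1 := (mem_sphere_zero_iff_norm.1 hz).trans abs_one
        have hnorm : ‖z • y‖ = ‖y‖ := by rw [norm_smul, hz1, one_mul]
        simp only [smul_eq_mul]
        rw [hK hz1, hnorm, Real.log_div (norm_ne_zero_iff.2 hy) (hsub hz), mul_comm]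
    _ = (Real.log ‖y‖ - Real.log (orbitMean x y)) * K y := by
        rw [Real.circleAverage_fun_smul,
          Real.circleAverage_fun_sub (circleIntegrable_const _ _ _) hint, Real.circleAverage_const,
          circleAverage_log_norm_sub_smul x hy, smul_eq_mul, mul_comm]

variable [FiniteDimensional ℂ E] [Nontrivial E] [MeasurableSpace E] [BorelSpace E]
  {μ : Measure E} [μ.IsAddHaarMeasure] {K u : E → ℝ}

theorem integrable_and_integral_log_orbitMean_mul (hK : IsCircleInvariant K)
    {x : E} (hlog : Integrable (fun y => Real.log (‖y‖ / ‖x - y‖) * K y) μ) :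
    Integrable (fun y => (Real.log ‖y‖ - Real.log (orbitMean x y)) * K y) μ ∧
      ∫ y, (Real.log ‖y‖ - Real.log (orbitMean x y)) * K y ∂μ =
        ∫ y, Real.log (‖y‖ / ‖x - y‖) * K y ∂μ := by
  have : FiniteDimensional ℝ E := .complexToReal E
  obtain ⟨hint, heq⟩ := integrable_and_integral_circleAverage_smul hlog
  have hae : ∀ᵐ y ∂μ,
      Real.circleAverage (fun z => Real.log (‖z • y‖ / ‖x - z • y‖) * K (z • y)) 0 1 =
        (Real.log ‖y‖ - Real.log (orbitMean x y)) * K y := by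
    filter_upwards [ae_ne_zero_and_norm_ne μ ‖x‖] with y hy
    exact circleAverage_log_div_mul hK hy.1 hy.2
  exact ⟨hint.congr hae, (integral_congr_ae hae).symm.trans heq⟩

theorem IsLogPotential.hasDerivAt_exp_smul (h : IsLogPotential μ K u)
    (hK : IsCircleInvariant K) (x : E) (t : ℝ) :
    HasDerivAt (fun s => u (Real.exp s • x))
      (-∫ y, orbitSlope (Real.exp t • x) y * K y ∂μ) t := by
  have : FiniteDimensional ℝ E := .complexToReal E
  have := FiniteDimensional.proper ℂ E
  obtain ⟨C, hC⟩ := h.exists_eq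
  have havg (s : ℝ) := integrable_and_integral_log_orbitMean_mul hK
    (h.integrable_log (Real.exp s • x))
  simp only [hC, ← (havg _).2, ← integral_neg]
  refine HasDerivAt.add_const C (hasDerivAt_integral_of_dominated_loc_of_lip
    (bound := fun y => |K y|) Filter.univ_mem (.of_forall fun s => (havg s).1.aestronglyMeasurable)
    (havg t).1 ?_ ?_ h.integrable.abs ?_).2
  · exact ((measurable_orbitSlope.comp measurable_prodMk_left).aestronglyMeasurable.mul
      h.integrable.aestronglyMeasurable).neg
  · filter_upwards [ae_ne_zero_and_norm_ne μ 0] with y hy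
    refine LipschitzOnWith.of_dist_le_mul fun a _ b _ => ?_
    rw [Real.dist_eq, Real.dist_eq, Real.coe_nnabs, abs_abs, ← sub_mul, abs_mul, mul_comm,
      sub_sub_sub_cancel_left, abs_sub_comm a b]
    exact mul_le_mul_of_nonneg_left (abs_log_orbitMean_exp_smul_sub_le x hy.1 b a) (abs_nonneg _)
  · filter_upwards [ae_ne_zero_and_norm_ne μ ‖Real.exp t • x‖] with y hy
    exact (((hasDerivAt_log_orbitMean_exp_smul hy.1 hy.2.symm).const_sub _).mul_const
      (K y)).congr_deriv (neg_mul _ _)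

end Potential

section Dilation

variable {V : Type*} [NormedAddCommGroup V] [NormedSpace ℝ V] [FiniteDimensional ℝ V]
  [MeasurableSpace V] [BorelSpace V] {μ : Measure V} [μ.IsAddHaarMeasure] {f g : V → ℝ}

theorem integral_comp_exp_smul (g : V → ℝ) (s : ℝ) :
    ∫ x, g (Real.exp s • x) ∂μ = Real.exp (-(Module.finrank ℝ V * s)) * ∫ x, g x ∂μ := by
  rw [Measure.integral_comp_smul_of_nonneg μ g _ (hR := (Real.exp_pos s).le), ← Real.exp_nat_mul,
    ← Real.exp_neg, smul_eq_mul]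

theorem aestronglyMeasurable_comp_exp_smul (hg : AEStronglyMeasurable g μ) (ν : Measure ℝ) :
    AEStronglyMeasurable (fun w : ℝ × V => g (Real.exp w.1 • w.2)) (ν.prod μ) := by
  have := FiniteDimensional.proper ℝ V
  have hslice (s : ℝ) : Measure.QuasiMeasurePreserving (fun x : V => Real.exp s • x) μ μ := by
    refine ⟨measurable_const_smul _, ?_⟩
    rw [Measure.map_addHaar_smul μ (Real.exp_ne_zero s)]
    exact Measure.smul_absolutelyContinuous
  exact hg.comp_quasiMeasurePreserving (QuasiMeasurePreserving.prod_of_right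
    (Continuous.measurable (by fun_prop)) (.of_forall hslice))

theorem integrable_comp_exp_smul (hg : Integrable g μ) (a b : ℝ) :
    Integrable (fun w : ℝ × V => g (Real.exp w.1 • w.2))
      ((volume.restrict (Set.Ioc a b)).prod μ) := by
  have := FiniteDimensional.proper ℝ V
  refine (integrable_prod_iff (aestronglyMeasurable_comp_exp_smul hg.1 _)).2
    ⟨.of_forall fun s => hg.comp_smul (Real.exp_ne_zero s), ?_⟩
  simp only [integral_comp_exp_smul (fun x => ‖g x‖)]
  have hexp : Continuous fun s : ℝ => Real.exp (-(Module.finrank ℝ V * s)) := by fun_prop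
  exact hexp.integrableOn_Ioc.mul_const _

/-- The Euler vector field has divergence `Module.finrank ℝ V`. -/
theorem integral_eq_neg_finrank_mul_of_hasDerivAt_exp_smul (hf : Integrable f μ)
    (hg : Integrable g μ)
    (h : ∀ x t, HasDerivAt (fun s => f (Real.exp s • x)) (g (Real.exp t • x)) t) :
    ∫ x, g x ∂μ = -(Module.finrank ℝ V * ∫ x, f x ∂μ) := by
  have := FiniteDimensional.proper ℝ V
  have hint := integrable_comp_exp_smul hg 0 1
  set d : ℝ := (Module.finrank ℝ V : ℝ)
  set I : ℝ := ∫ s in (0 : ℝ)..1, Real.exp (-(d * s)) with hI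
  have hI_pos : 0 < I := intervalIntegral.intervalIntegral_pos_of_pos
    (Continuous.intervalIntegrable (by fun_prop) _ _) (fun _ => Real.exp_pos _) one_pos
  have hI_mul : d * I = 1 - Real.exp (-d) := by
    rw [hI, intervalIntegral.mul_integral_comp_mul_left (f := fun s => Real.exp (-s)),
      intervalIntegral.integral_comp_neg, integral_exp, mul_zero, mul_one, neg_zero,
      Real.exp_zero]
  have hftc : ∀ᵐ x ∂μ,
      ∫ s in Set.Ioc (0 : ℝ) 1, g (Real.exp s • x) = f (Real.exp 1 • x) - f x := by
    filter_upwards [hint.prod_left_ae] with x hx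
    rw [← intervalIntegral.integral_of_le zero_le_one,
      intervalIntegral.integral_eq_sub_of_hasDerivAt (fun t _ => h x t), Real.exp_zero, one_smul]
    exact (intervalIntegrable_iff_integrableOn_Ioc_of_le zero_le_one).2 hx
  have hleft : ∫ x, (∫ s in Set.Ioc (0 : ℝ) 1, g (Real.exp s • x)) ∂μ = I * ∫ x, g x ∂μ := by
    rw [← integral_prod_symm _ hint, integral_prod _ hint]
    simp only [integral_comp_exp_smul]
    rw [integral_mul_const, hI, intervalIntegral.integral_of_le zero_le_one]
  have hright : ∫ x, (f (Real.exp 1 • x) - f x) ∂μ = -(d * I) * ∫ x, f x ∂μ := by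
    rw [integral_sub (hf.comp_smul (Real.exp_ne_zero 1)) hf, integral_comp_exp_smul, hI_mul,
      mul_one]
    ring
  rw [integral_congr_ae hftc, hright] at hleft
  refine mul_left_cancel₀ hI_pos.ne' ?_
  linarith

end Dilation

/-- The bilinear form of the kernel `orbitSlope`. It measures the interaction of two densities in
Pohozaev's identity `IsLogPotential.finrank_add_mul_integral_eq_mul_slopeForm`. -/
noncomputable def slopeForm {E : Type*} [NormedAddCommGroup E] [InnerProductSpace ℂ E]
    [MeasurableSpace E] (μ : Measure E) (f g : E → ℝ) : ℝ :=
  ∫ z : E × E, orbitSlope z.1 z.2 * (f z.1 * g z.2) ∂μ.prod μ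

section SlopeForm

variable {E : Type*} [NormedAddCommGroup E] [InnerProductSpace ℂ E] [SecondCountableTopology E]
  [MeasurableSpace E] [BorelSpace E] {μ : Measure E} {f g h : E → ℝ}

theorem integrable_orbitSlope_mul (hf : Integrable f μ) (hg : Integrable g μ) :
    Integrable (fun z : E × E => orbitSlope z.1 z.2 * (f z.1 * g z.2)) (μ.prod μ) := by
  refine (hf.mul_prod hg).bdd_mul (c := 1) measurable_orbitSlope.aestronglyMeasurable
    (.of_forall fun z => ?_)
  rw [Real.norm_of_nonneg (orbitSlope_nonneg z.1 z.2)]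
  exact orbitSlope_le_one z.1 z.2

theorem slopeForm_add_right (hf : Integrable f μ) (hg : Integrable g μ) (hh : Integrable h μ) :
    slopeForm μ f (g + h) = slopeForm μ f g + slopeForm μ f h := by
  rw [slopeForm, slopeForm, slopeForm,
    ← integral_add (integrable_orbitSlope_mul hf hg) (integrable_orbitSlope_mul hf hh)]
  simp only [Pi.add_apply, mul_add]

variable [SFinite μ]

theorem slopeForm_eq_integral_mul_integral (hf : Integrable f μ) (hg : Integrable g μ) :
    slopeForm μ f g = ∫ x, f x * ∫ y, orbitSlope x y * g y ∂μ ∂μ := by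
  rw [slopeForm, integral_prod _ (integrable_orbitSlope_mul hf hg)]
  simp only [mul_left_comm (orbitSlope _ _), integral_const_mul]

theorem slopeForm_add_swap (hf : Integrable f μ) (hg : Integrable g μ) :
    slopeForm μ f g + slopeForm μ g f = (∫ x, f x ∂μ) * ∫ x, g x ∂μ := by
  have hswap : Integrable (fun z : E × E => orbitSlope z.2 z.1 * (g z.2 * f z.1)) (μ.prod μ) :=
    (integrable_orbitSlope_mul hg hf).swap
  have hcomm : slopeForm μ g f = ∫ z : E × E, orbitSlope z.2 z.1 * (g z.2 * f z.1) ∂μ.prod μ :=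
    (integral_prod_swap _).symm
  rw [hcomm, slopeForm, ← integral_add (integrable_orbitSlope_mul hf hg) hswap,
    ← integral_prod_mul]
  congr 1 with z
  linear_combination f z.1 * g z.2 * orbitSlope_add_swap z.1 z.2

theorem slopeForm_self (hf : Integrable f μ) : slopeForm μ f f = (∫ x, f x ∂μ) ^ 2 / 2 := by
  linarith [slopeForm_add_swap hf hf]

theorem slopeForm_pos [Nontrivial E] [μ.IsOpenPosMeasure] (hf : Integrable f μ)
    (hg : Integrable g μ) (hf0 : 0 ≤ f) (hg0 : 0 ≤ g) (hf_pos : ∀ x ≠ 0, 0 < f x)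
    (hg_pos : ∀ x ≠ 0, 0 < g x) : 0 < slopeForm μ f g := by
  have hnonneg (z : E × E) : 0 ≤ orbitSlope z.1 z.2 * (f z.1 * g z.2) :=
    mul_nonneg (orbitSlope_nonneg _ _) (mul_nonneg (hf0 _) (hg0 _))
  set U : Set (E × E) := {z | 0 < ‖z.2‖ ∧ ‖z.2‖ < ‖z.1‖}
  have hU_open : IsOpen U :=
    (isOpen_lt continuous_const continuous_snd.norm).inter
      (isOpen_lt continuous_snd.norm continuous_fst.norm)
  have hU_nonempty : U.Nonempty := by
    obtain ⟨v, hv⟩ := exists_ne (0 : E)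
    have := norm_pos_iff.2 hv
    refine ⟨((2 : ℝ) • v, v), this, ?_⟩
    rw [norm_smul, Real.norm_ofNat]
    linarith
  rw [slopeForm, integral_pos_iff_support_of_nonneg hnonneg (integrable_orbitSlope_mul hf hg)]
  refine (hU_open.measure_pos _ hU_nonempty).trans_le (measure_mono ?_)
  rintro ⟨x, y⟩ ⟨hy, hyx⟩
  have hx_pos := hf_pos x (norm_pos_iff.1 (hy.trans hyx))
  have hy_pos := hg_pos y (norm_pos_iff.1 hy)
  exact (mul_pos (orbitSlope_pos hyx) (mul_pos hx_pos hy_pos)).ne'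

end SlopeForm

section Balance

variable {E : Type*} [NormedAddCommGroup E] [InnerProductSpace ℂ E] [FiniteDimensional ℂ E]
  [Nontrivial E] [MeasurableSpace E] [BorelSpace E] {μ : Measure E} [μ.IsAddHaarMeasure]
  {K u : E → ℝ}

/-- Pohozaev's identity. -/
theorem IsLogPotential.finrank_add_mul_integral_eq_mul_slopeForm (hu : IsLogPotential μ K u)
    (hK : IsCircleInvariant K) {a c q : ℝ}
    (hf : Integrable (fun x => ‖x‖ ^ q * (c * Real.exp (a * u x))) μ) :
    (Module.finrank ℝ E + q) * ∫ x, ‖x‖ ^ q * (c * Real.exp (a * u x)) ∂μ =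
      a * slopeForm μ (fun x => ‖x‖ ^ q * (c * Real.exp (a * u x))) K := by
  have : FiniteDimensional ℝ E := .complexToReal E
  have := FiniteDimensional.proper ℂ E
  set f : E → ℝ := fun x => ‖x‖ ^ q * (c * Real.exp (a * u x)) with hf_def
  have hslope : Integrable (fun x => f x * ∫ y, orbitSlope x y * K y ∂μ) μ := by
    have := (integrable_orbitSlope_mul hf hu.integrable).integral_prod_left
    simpa only [mul_left_comm (orbitSlope _ _), integral_const_mul] using this
  have hpow (x : E) (s : ℝ) : ‖Real.exp s • x‖ ^ q = Real.exp (s * q) * ‖x‖ ^ q := by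
    rw [norm_smul_of_nonneg (Real.exp_pos s).le, Real.mul_rpow (Real.exp_pos s).le (norm_nonneg x),
      Real.exp_mul]
  have hderiv (x : E) (t : ℝ) : HasDerivAt (fun s => f (Real.exp s • x))
      (q * f (Real.exp t • x) -
        a * (f (Real.exp t • x) * ∫ y, orbitSlope (Real.exp t • x) y * K y ∂μ)) t := by
    simp only [hf_def, hpow]
    refine (((((hasDerivAt_id t).mul_const q).exp).mul_const (‖x‖ ^ q)).fun_mul
      (((hu.hasDerivAt_exp_smul hK x t).const_mul a).exp.const_mul c)).congr_deriv ?_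
    simp only [id]
    ring
  have hEuler := integral_eq_neg_finrank_mul_of_hasDerivAt_exp_smul hf
    ((hf.const_mul q).sub (hslope.const_mul a)) hderiv
  simp only [Pi.sub_apply] at hEuler
  rw [integral_sub (hf.const_mul q) (hslope.const_mul a), integral_const_mul, integral_const_mul,
    ← slopeForm_eq_integral_mul_integral hf hu.integrable] at hEuler
  linarith

end Balance

section Bounds

theorem integrable_and_integrable_mul_of_integrable_one_add_mul {α : Type*} [MeasurableSpace α]
    {μ : Measure α} {w g : α → ℝ} (hw : AEStronglyMeasurable w μ) (hw0 : 0 ≤ w)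
    (h : Integrable (fun x => (1 + w x) * g x) μ) :
    Integrable g μ ∧ Integrable (fun x => w x * g x) μ := by
  have hpos (x : α) : 0 < 1 + w x := add_pos_of_pos_of_nonneg one_pos (hw0 x)
  have hbound (x : α) : ‖(1 + w x)⁻¹‖ ≤ 1 := by
    rw [Real.norm_of_nonneg (inv_pos.2 (hpos x)).le]
    exact inv_le_one_of_one_le₀ (le_add_of_nonneg_right (hw0 x))
  have hinv : AEStronglyMeasurable (fun x => (1 + w x)⁻¹) μ :=
    (hw.const_add 1).aemeasurable.inv.aestronglyMeasurable
  have hg : Integrable g μ := by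
    simpa only [inv_mul_cancel_left₀ (hpos _).ne'] using h.bdd_mul hinv (.of_forall hbound)
  refine ⟨hg, ?_⟩
  simpa only [Pi.sub_def, add_mul, one_mul, add_sub_cancel_left] using h.sub hg

theorem max_lt_add_and_add_lt_of_balance {d q b₀ b₁ s₀ s₁ : ℝ} (hd : 0 < d) (hq : 0 < q)
    (hs₀ : 0 < s₀) (hs₁ : 0 < s₁) (hs : s₀ + s₁ = b₀ * b₁) (h₀ : d * b₀ = b₀ ^ 2 / 2 + s₀)
    (h₁ : (d + q) * b₁ = b₁ ^ 2 / 2 + s₁) :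
    max (2 * d) (2 * q) < b₀ + b₁ ∧ b₀ + b₁ < 2 * d + 2 * q := by
  have hb₀ : 0 < b₀ := pos_of_mul_pos_right (h₀ ▸ by positivity) hd.le
  have hb₁ : 0 < b₁ := pos_of_mul_pos_right (h₁ ▸ by positivity) (add_pos hd hq).le
  have hb₀_lt : 0 < 2 * d - b₀ := by
    refine pos_of_mul_pos_right (a := b₀) ?_ hb₀.le
    linarith
  have hmul_d : (b₀ + b₁) * (b₀ + b₁ - 2 * d) = 2 * q * b₁ := by
    linear_combination -2 * h₀ - 2 * h₁ - 2 * hs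
  have hmul_q : (b₀ + b₁ - 2 * d) * (b₀ + b₁ - 2 * q) = 2 * q * (2 * d - b₀) := by
    linear_combination hmul_d
  have hmul_upper : (b₀ + b₁) * (2 * d + 2 * q - (b₀ + b₁)) = 2 * q * b₀ := by
    linear_combination -hmul_d
  have hlower_d : 0 < b₀ + b₁ - 2 * d :=
    pos_of_mul_pos_right (hmul_d ▸ by positivity) (add_pos hb₀ hb₁).le
  have hlower_q : 0 < b₀ + b₁ - 2 * q := pos_of_mul_pos_right (hmul_q ▸ by positivity) hlower_d.le
  have hupper : 0 < 2 * d + 2 * q - (b₀ + b₁) :=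
    pos_of_mul_pos_right (hmul_upper ▸ by positivity) (add_pos hb₀ hb₁).le
  exact ⟨max_lt (sub_pos.1 hlower_d) (sub_pos.1 hlower_q), sub_pos.1 hupper⟩

variable {E : Type*} [NormedAddCommGroup E] [InnerProductSpace ℂ E] [FiniteDimensional ℂ E]
  [Nontrivial E] [MeasurableSpace E] [BorelSpace E] {μ : Measure E} [μ.IsAddHaarMeasure]

theorem mainTheorem5_general {a c q : ℝ} (ha : 0 < a) (hc : 0 < c) (hq : 0 < q) {u : E → ℝ}
    (hu : IsLogPotential μ (fun x => (1 + ‖x‖ ^ q) * (c * Real.exp (a * u x))) u)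
    (hu_inv : IsCircleInvariant u) :
    max (2 * (Module.finrank ℝ E : ℝ)) (2 * q) <
        a * ∫ x, (1 + ‖x‖ ^ q) * (c * Real.exp (a * u x)) ∂μ ∧
      a * ∫ x, (1 + ‖x‖ ^ q) * (c * Real.exp (a * u x)) ∂μ <
        2 * (Module.finrank ℝ E : ℝ) + 2 * q := by
  have : FiniteDimensional ℝ E := .complexToReal E
  have := FiniteDimensional.proper ℂ E
  set k : ℝ → E → ℝ := fun r x => ‖x‖ ^ r * (c * Real.exp (a * u x)) with hk
  have hK : (fun x => (1 + ‖x‖ ^ q) * (c * Real.exp (a * u x))) = k 0 + k q := by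
    ext x
    simp only [hk, Pi.add_apply, Real.rpow_zero, add_mul]
  have hK_inv : IsCircleInvariant (k 0 + k q) := fun z hz x => by
    simp only [hk, Pi.add_apply, norm_smul, hz, one_mul, hu_inv hz]
  have hform_pos (r s : ℝ) (hr : Integrable (k r) μ) (hs : Integrable (k s) μ) :
      0 < a ^ 2 * slopeForm μ (k r) (k s) := by
    have hk_nonneg (r : ℝ) : 0 ≤ k r := fun x => by positivity
    have hk_pos (r : ℝ) (x : E) (hx : x ≠ 0) : 0 < k r x := by
      have := norm_pos_iff.2 hx
      positivity
    exact mul_pos (pow_pos ha 2)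
      (slopeForm_pos hr hs (hk_nonneg r) (hk_nonneg s) (hk_pos r) (hk_pos s))
  obtain ⟨hk₀, hkq⟩ : Integrable (k 0) μ ∧ Integrable (k q) μ := by
    simpa only [hk, Real.rpow_zero, one_mul] using
      integrable_and_integrable_mul_of_integrable_one_add_mul
        (measurable_norm.pow_const q).aestronglyMeasurable (fun x => by positivity) hu.integrable
  rw [hK] at hu ⊢
  have hpohozaev₀ := hu.finrank_add_mul_integral_eq_mul_slopeForm hK_inv hk₀
  have hpohozaev := hu.finrank_add_mul_integral_eq_mul_slopeForm hK_inv hkq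
  rw [slopeForm_add_right hk₀ hk₀ hkq, slopeForm_self hk₀, add_zero] at hpohozaev₀
  rw [slopeForm_add_right hkq hk₀ hkq, slopeForm_self hkq] at hpohozaev
  rw [integral_add' hk₀ hkq, mul_add]
  refine max_lt_add_and_add_lt_of_balance (Nat.cast_pos.2 Module.finrank_pos) hq
    (hform_pos 0 q hk₀ hkq) (hform_pos q 0 hkq hk₀) ?_ ?_ ?_
  · linear_combination a ^ 2 * slopeForm_add_swap hk₀ hkq
  · linear_combination a * hpohozaev₀
  · linear_combination a * hpohozaev

end Bounds

theorem sphereVolume_pos (n : ℕ) : 0 < sphereVolume n := by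
  unfold sphereVolume
  rw [measureReal_def, ENNReal.toReal_pos_iff]
  exact ⟨pos_iff_ne_zero.2 (Measure.measure_univ_ne_zero.2 (Measure.toSphere_ne_zero _)),
    measure_lt_top _ _⟩

theorem normConst_pos (n : ℕ) : 0 < normConst n := by
  have := sphereVolume_pos n
  unfold normConst
  positivity

theorem IsLogPotential.map_linearIsometryEquiv {V W : Type*} [NormedAddCommGroup V]
    [NormedSpace ℝ V] [MeasurableSpace V] [BorelSpace V] [NormedAddCommGroup W] [NormedSpace ℝ W]
    [MeasurableSpace W] [BorelSpace W] {μ : Measure V} {K u : V → ℝ} (h : IsLogPotential μ K u)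
    (e : V ≃ₗᵢ[ℝ] W) : IsLogPotential (μ.map e) (K ∘ e.symm) (u ∘ e.symm) := by
  have he : MeasurableEmbedding e := e.toHomeomorph.measurableEmbedding
  have hcomp (x : W) : (fun y => Real.log (‖y‖ / ‖x - y‖) * (K ∘ e.symm) y) ∘ e =
      fun y => Real.log (‖y‖ / ‖e.symm x - y‖) * K y := by
    ext y
    have hsub : ‖x - e y‖ = ‖e.symm x - y‖ := by
      rw [← e.symm.norm_map (x - e y), map_sub, e.symm_apply_apply]
    simp only [Function.comp_apply, e.norm_map, e.symm_apply_apply, hsub]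
  obtain ⟨C, hC⟩ := h.exists_eq
  refine ⟨he.integrable_map_iff.2 ?_, fun x => he.integrable_map_iff.2 ?_, C, fun x => ?_⟩
  · simpa only [Function.comp_def, e.symm_apply_apply] using h.integrable
  · rw [hcomp]
    exact h.integrable_log (e.symm x)
  · rw [he.integral_map, Function.comp_apply, hC]
    exact congrArg (fun g : V → ℝ => ∫ y, g y ∂μ + C) (hcomp x).symm

theorem nonempty_linearIsometryEquiv_of_finrank_eq {E : Type*} [NormedAddCommGroup E]
    [InnerProductSpace ℂ E] [FiniteDimensional ℂ E] {n : ℕ} (hn : Module.finrank ℝ E = n) :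
    Nonempty (EuclideanSpace ℝ (Fin n) ≃ₗᵢ[ℝ] E) := by
  let _ := InnerProductSpace.rclikeToReal ℂ E
  have : FiniteDimensional ℝ E := .complexToReal E
  exact ⟨((stdOrthonormalBasis ℝ E).reindex (finCongr hn)).repr.symm⟩

theorem IsNormalSolution.isLogPotential {n : ℕ} {Q u : EuclideanSpace ℝ (Fin n) → ℝ}
    (hu : IsNormalSolution n Q u) :
    IsLogPotential volume (fun x => Q x * (normConst n * Real.exp (n * u x))) u := by
  obtain ⟨C, hC⟩ := hu.equation
  refine ⟨?_, fun x => ?_, C, fun x => ?_⟩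
  · simpa only [mul_left_comm] using hu.integrable.const_mul (normConst n)
  · simpa only [mul_left_comm] using (hu.integrable_log x).const_mul (normConst n)
  · rw [hC, ← integral_const_mul]
    simp only [mul_left_comm]

theorem normalizedTotalQ_eq_integral_map {n : ℕ} {W : Type*} [NormedAddCommGroup W]
    [NormedSpace ℝ W] [MeasurableSpace W] [BorelSpace W] (Q u : EuclideanSpace ℝ (Fin n) → ℝ)
    (e : EuclideanSpace ℝ (Fin n) ≃ₗᵢ[ℝ] W) :
    normalizedTotalQ n Q u = ∫ x, Q (e.symm x) * (normConst n * Real.exp (n * u (e.symm x)))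
      ∂volume.map e := by
  have he : MeasurableEmbedding e := e.toHomeomorph.measurableEmbedding
  rw [he.integral_map, normalizedTotalQ, ← integral_const_mul]
  simp only [e.symm_apply_apply, mul_left_comm]

theorem IsRadial.isCircleInvariant_comp_symm {n : ℕ} {E : Type*} [NormedAddCommGroup E]
    [NormedSpace ℂ E] {u : EuclideanSpace ℝ (Fin n) → ℝ} (hu : IsRadial u)
    (e : EuclideanSpace ℝ (Fin n) ≃ₗᵢ[ℝ] E) : IsCircleInvariant (u ∘ e.symm) := by
  refine fun z hz x => hu _ _ ?_
  rw [e.symm.norm_map, e.symm.norm_map, norm_smul, hz, one_mul]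

theorem mainTheorem5 (n : ℕ) (hn : 2 ≤ n) (hn_even : Even n) (p : ℝ) (hp : 0 < p)
    (u : EuclideanSpace ℝ (Fin n) → ℝ)
    (hu : IsNormalSolution n (powerQ n p) u) (hu_radial : IsRadial u) :
    max 2 (2 * p) < normalizedTotalQ n (powerQ n p) u ∧
      normalizedTotalQ n (powerQ n p) u < 2 + 2 * p := by
  obtain ⟨m, hm⟩ := hn_even
  have hn_pos : (0 : ℝ) < n := Nat.cast_pos.2 (two_pos.trans_le hn)
  have : NeZero m := ⟨by lia⟩
  have hdim : Module.finrank ℝ (EuclideanSpace ℂ (Fin m)) = n := by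
    rw [finrank_real_of_complex, finrank_euclideanSpace_fin, hm, two_mul]
  obtain ⟨e⟩ := nonempty_linearIsometryEquiv_of_finrank_eq hdim
  have : (volume.map e).IsAddHaarMeasure :=
    e.toContinuousLinearEquiv.isAddHaarMeasure_map volume
  have hQ (x : EuclideanSpace ℂ (Fin m)) : powerQ n p (e.symm x) = 1 + ‖x‖ ^ ((n : ℝ) * p) := by
    rw [powerQ, e.symm.norm_map]
  have hpot := hu.isLogPotential.map_linearIsometryEquiv e
  have htotal := normalizedTotalQ_eq_integral_map (powerQ n p) u e
  simp only [Function.comp_def, hQ] at hpot htotal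
  have hbounds := mainTheorem5_general hn_pos (normConst_pos n) (mul_pos hn_pos hp) hpot
    (hu_radial.isCircleInvariant_comp_symm e)
  rwa [← htotal, hdim, mul_comm 2 (n : ℝ), mul_left_comm 2, ← mul_add,
    ← mul_max_of_nonneg _ _ hn_pos.le, mul_lt_mul_iff_right₀ hn_pos,
    mul_lt_mul_iff_right₀ hn_pos] at hbounds
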